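/- Let $H$ be a (real or complex) Hilbert space with $3 \le \dim H < \infty$. Let $L(H)$ be the lattice of closed subspaces of $H$, with least element $\bot=\{0\}$, greatest element $\top=H$ and orthocomplement $p\mapsto p^\perp$. For $p,q\in L(H)$ put $p \mathbin{\&} q = q\wedge(p\vee q^\perp)$ (the Sasaki projection), and let $\Pi_p$ be the orthogonal projection onto $p$. A graph $\mathfrak G=(A,M)$ is a set $A$ with a relation $M\subseteq A\times L(H)\times A$; $M(a,p,b)$ is read as an arrow from $a$ to $b$ with label $p$. Say that $a\in A$ verifies $p$, written $a\vDash p$, if there is no $b\in A$ with $M(a,p^\perp,b)$. The graph $\mathfrak G$ is a model of the measurement theory $\mathcal T_{L(H)}$ if, for all $p,q\in L(H)$ and $a,b\in A$: 1. $a\vDash\top$; 2. not $a\vDash\bot$; 3. if $p\ne\top$, then some $c\in A$ does not verify $p$; 4. if $p\le q$ and $a\vDash p$, then $a\vDash q$; 5. if $a\vDash p$ and $a\vDash q$, then $a\vDash p\mathbin{\&}q$; 6. if $a\vDash p$ and $M(a,q,b)$, then $b\vDash p\mathbin{\&}q$. The language $\ell(\mathfrak G)$ is the set of finite words $p_1p_2\cdots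 p_n$ $(n\ge 0)$ over $L(H)$ for which there are $a_0,a_1,\dots,a_n\in A$ with $M(a_{k-1},p_k,a_k)$ for $1\le k\le n$. The lattice graph $\mathfrak L$ has as vertices the elements of $L(H)\setminus\{\bot\}$, with $M(a,p,b)$ iff $b\le a\mathbin{\&}p$. The Hilbert graph $\mathfrak H$ has as vertices the unit vectors of $H$, with $M(\varphi,p,\psi)$ iff $\Pi_p\varphi\neq 0$ and $\psi=\Pi_p\varphi/\|\Pi_p\varphi\|$. **Theorem.** Every model $\mathfrak G$ of $\mathcal T_{L(H)}$ satisfies $$\ell(\mathfrak G)=\ell(\mathfrak L)=\ell(\mathfrak H).$$ The equality $\ell(\mathfrak L)=\ell(\mathfrak H)$ holds independently of any model. Moreover, for every word $p_1p_2\cdots p_n$ over $L(H)$, $$p_1\cdots p_n\in\ell(\mathfrak L)\iff(\cdots(p_1\mathbin{\&}p_2)\mathbin{\&}\cdots)\mathbin{\&}p_n\neq\bot,\qquad p_1\cdots p_n\in\ell(\mathfrak H)\iff\Pi_{p_n}\cdots\Pi_{p_2}\Pi_{p_1}\neq 0,$$ so that all these conditions are equivalent, and each of them is equivalent to $p_1\cdots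 p_n\in\ell(\mathfrak G)$ for any model $\mathfrak G$. For the empty word the iterated Sasaki projection is read as $\top$ and the product of projections as the identity. -/

import Mathlib

universe u v

/-- An orthomodular lattice: a bounded lattice with an order-reversing involutive
complement `pᶜ` (written `p^⊥` on paper) that satisfies the orthomodular law. -/
class OrthomodularLattice (L : Type u) [Lattice L] [BoundedOrder L] extends Compl L where
  compl_compl' : ∀ p : L, pᶜᶜ = p
  compl_antitone' : ∀ p q : L, p ≤ q → qᶜ ≤ pᶜ
  inf_compl' : ∀ p : L, p ⊓ pᶜ = ⊥
  sup_compl' : ∀ p : L, p ⊔ pᶜ = ⊤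
  orthomodular' : ∀ p q : L, p ≤ q → p ⊔ (pᶜ ⊓ q) = q

/-- A directed graph `(A, M)` whose arrows carry labels in `L`; `G.Mes a p b` says that there is
an arrow from `a` to `b` with label `p`. -/
structure MeasurementGraph (L : Type u) where
  /-- the universe of the graph -/
  Vertex : Type v
  /-- the ternary relation of the graph -/
  Mes : Vertex → L → Vertex → Prop

namespace MeasurementGraph

/-- The language of a graph: the words that label a path `a₀, a₁, …, aₙ`. -/
def language {L : Type u} (G : MeasurementGraph.{u, v} L) : Language L :=
  {w : List L | ∃ a : Fin (w.length + 1) → G.Vertex,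
    ∀ k : Fin w.length, G.Mes (a k.castSucc) (w.get k) (a k.succ)}

end MeasurementGraph

section Orthomodular

variable {L : Type u} [Lattice L] [BoundedOrder L] [OrthomodularLattice L]

/-- The Sasaki projection `p & q = q ∧ (p ∨ q^⊥)`, that is, `p` projected onto `q`. -/
def sasaki (p q : L) : L := q ⊓ (p ⊔ qᶜ)

/-- The iterated Sasaki projection `(⋯((p₁ & p₂) & p₃)⋯) & pₙ` of a word, associated to the left;
it is `⊤` for the empty word. -/
def sasakiWord : List L → L
  | [] => ⊤
  | p :: w => w.foldl sasaki p

/-- `G.Verifies a p`: the outcome `p^⊥` cannot be obtained from `a`. -/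
def MeasurementGraph.Verifies (G : MeasurementGraph.{u, v} L) (a : G.Vertex) (p : L) : Prop :=
  ¬ ∃ b : G.Vertex, G.Mes a pᶜ b

/-- `G` is a model of the measurement theory of `L`: it satisfies all its axioms. -/
structure MeasurementGraph.IsModel (G : MeasurementGraph.{u, v} L) : Prop where
  verifies_top : ∀ a, G.Verifies a ⊤
  not_verifies_bot : ∀ a, ¬ G.Verifies a ⊥
  exists_not_verifies : ∀ p : L, p ≠ ⊤ → ∃ a, ¬ G.Verifies a p
  verifies_mono : ∀ p q : L, p ≤ q → ∀ a, G.Verifies a p → G.Verifies a q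
  verifies_sasaki : ∀ p q : L, ∀ a, G.Verifies a p → G.Verifies a q → G.Verifies a (sasaki p q)
  preservation : ∀ p q : L, ∀ a b, G.Verifies a p → G.Mes a q b → G.Verifies b (sasaki p q)

variable (L) in
/-- The lattice graph: its vertices are the elements of `L` other than `⊥`, with an arrow from `a`
to `b` labelled `p` when `b ≤ a & p`. -/
def latticeGraph : MeasurementGraph.{u, u} L where
  Vertex := {a : L // a ≠ ⊥}
  Mes a p b := (b : L) ≤ sasaki (a : L) p

end Orthomodular

noncomputable section Hilbert

variable (𝕜 : Type v) (H : Type u) [RCLike 𝕜] [NormedAddCommGroup H] [InnerProductSpace 𝕜 H]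
  [CompleteSpace H]

/-- The Hilbert lattice `L(H)`: the closed subspaces of `H`, with the orthogonal complement. -/
instance ClosedSubmodule.instOrthomodularLattice :
    OrthomodularLattice (ClosedSubmodule 𝕜 H) where
  compl K := Kᗮ
  compl_compl' K := K.orthogonal_orthogonal_eq
  compl_antitone' _ _ h := ClosedSubmodule.orthogonal_le h
  inf_compl' K := by
    apply ClosedSubmodule.toSubmodule_injective
    exact K.toSubmodule.inf_orthogonal_eq_bot
  sup_compl' K := by
    refine top_le_iff.mp fun x _ => ?_
    have h : K.toSubmodule ⊔ K.toSubmoduleᗮ ≤ (K ⊔ Kᗮ).toSubmodule :=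
      sup_le (le_sup_left (a := K) (b := Kᗮ)) (le_sup_right (a := K) (b := Kᗮ))
    rw [Submodule.sup_orthogonal_of_hasOrthogonalProjection] at h
    exact h Submodule.mem_top
  orthomodular' K₁ K₂ h := by
    refine le_antisymm (sup_le h inf_le_right) ?_
    have h' : K₁.toSubmodule ⊔ K₁.toSubmoduleᗮ ⊓ K₂.toSubmodule ≤
        (K₁ ⊔ K₁ᗮ ⊓ K₂).toSubmodule :=
      sup_le (le_sup_left (a := K₁) (b := K₁ᗮ ⊓ K₂)) (le_sup_right (a := K₁) (b := K₁ᗮ ⊓ K₂))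
    rwa [Submodule.sup_orthogonal_inf_of_hasOrthogonalProjection h] at h'

/-- The Hilbert graph: its vertices are the unit vectors of `H`, with an arrow from `φ` to `ψ`
labelled `p` when the orthogonal projection of `φ` on `p` is nonzero and normalizes to `ψ`. -/
def hilbertGraph : MeasurementGraph.{u, u} (ClosedSubmodule 𝕜 H) where
  Vertex := {φ : H // ‖φ‖ = 1}
  Mes φ p ψ := ‖p.toSubmodule.starProjection (φ : H)‖ ≠ 0 ∧
    (ψ : H) = ((‖p.toSubmodule.starProjection (φ : H)‖⁻¹ : ℝ) : 𝕜) •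
      p.toSubmodule.starProjection (φ : H)

variable {𝕜 H}

/-- The product `Π_{pₙ} ⋯ Π_{p₂} Π_{p₁}` of the orthogonal projections of a word `p₁ p₂ ⋯ pₙ`
(the identity for the empty word). -/
def projectionWord (w : List (ClosedSubmodule 𝕜 H)) : H →L[𝕜] H :=
  (w.map fun p => p.toSubmodule.starProjection).reverse.prod

end Hilbert

/-! In finite dimension `sasaki p q` is the image of `p` under the projection onto `q`, so the
iterated Sasaki projection of a word is the range of its product of projections
(`mem_foldl_sasaki_iff`). This identifies the languages of the lattice graph and the Hilbert graph.
In a model, preservation carries the Sasaki projection along a path, and no vertex verifies `⊥`;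
hence every word of the model has nonzero product. For the converse, take `x` not killed by the
product and a vertex that verifies the line of `x`. The path can be continued from such a vertex
provided that it verifies only propositions that contain `x` (`mem_of_line`): if the next label `p`
were blocked, `pᶜ` would be verified, and `x` would be killed by the projection onto `p`. The proof
of `mem_of_line` is geometric. If a Sasaki closed `T` contains the line of `x` and some `p` without
`x`, it contains two distinct lines. Projections inside `T`, using a third dimension, then produce
pairs of lines at ever larger angles. Yet this angle is bounded away from a right angle, since `T`
contains no orthogonal lines. -/

/-! ### Paths in a labelled graph. -/

namespace MeasurementGraph

/-- `G.Reads a w`: the word `w` labels a path of `G` that starts at `a`. -/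
def Reads {L : Type u} (G : MeasurementGraph.{u, v} L) : G.Vertex → List L → Prop
  | _, [] => True
  | a, p :: w => ∃ b, G.Mes a p b ∧ G.Reads b w

theorem reads_iff_exists_path {L : Type u} (G : MeasurementGraph.{u, v} L) (w : List L)
    (a₀ : G.Vertex) :
    G.Reads a₀ w ↔ ∃ a : Fin (w.length + 1) → G.Vertex, a 0 = a₀ ∧
      ∀ k : Fin w.length, G.Mes (a k.castSucc) (w.get k) (a k.succ) := by
  induction w generalizing a₀ with
  | nil => exact ⟨fun _ => ⟨fun _ => a₀, rfl, fun k => k.elim0⟩, fun _ => trivial⟩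
  | cons p w ih =>
    constructor
    · rintro ⟨b, hb, hw⟩
      obtain ⟨a, rfl, ha⟩ := (ih b).1 hw
      refine ⟨Fin.cons a₀ a, rfl, fun k => ?_⟩
      induction k using Fin.cases with
      | zero => exact hb
      | succ k => exact ha k
    · rintro ⟨a, rfl, ha⟩
      exact ⟨a 1, ha 0, (ih _).2 ⟨fun k => a k.succ, rfl, fun k => ha k.succ⟩⟩

theorem mem_language_iff {L : Type u} (G : MeasurementGraph.{u, v} L) (w : List L) :
    w ∈ G.language ↔ ∃ a, G.Reads a w := by
  simp only [reads_iff_exists_path]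
  exact ⟨fun ⟨a, ha⟩ => ⟨a 0, a, rfl, ha⟩, fun ⟨_, a, _, ha⟩ => ⟨a, ha⟩⟩

end MeasurementGraph

/-! ### Sasaki projections, the lattice graph and the easy consequences of the axioms. -/

section Orthomodular

variable {L : Type u} [Lattice L] [BoundedOrder L] [OrthomodularLattice L]

theorem compl_top_orthomodular : (⊤ : L)ᶜ = ⊥ := by
  simpa using OrthomodularLattice.inf_compl' (⊤ : L)

theorem sasaki_mono_left {p p' : L} (h : p ≤ p') (q : L) : sasaki p q ≤ sasaki p' q :=
  inf_le_inf_left q (sup_le_sup_right h _)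

theorem bot_sasaki (q : L) : sasaki ⊥ q = ⊥ := by
  simp [sasaki, OrthomodularLattice.inf_compl']

theorem top_sasaki (q : L) : sasaki ⊤ q = q := by simp [sasaki]

theorem foldl_sasaki_mono (w : List L) {p p' : L} (h : p ≤ p') :
    w.foldl sasaki p ≤ w.foldl sasaki p' := by
  induction w generalizing p p' with
  | nil => exact h
  | cons q w ih => exact ih (sasaki_mono_left h q)

theorem foldl_sasaki_bot (w : List L) : w.foldl sasaki (⊥ : L) = ⊥ := by
  induction w with
  | nil => rfl
  | cons q w ih => rw [List.foldl_cons, bot_sasaki, ih]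

theorem sasakiWord_eq_foldl (w : List L) : sasakiWord w = w.foldl sasaki ⊤ := by
  cases w with
  | nil => rfl
  | cons p w => rw [List.foldl_cons, top_sasaki]; rfl

/-- By monotonicity of the Sasaki projection, the best target of an arrow is the largest one,
`sasaki a p` itself. -/
theorem latticeGraph_reads_iff (w : List L) (a : (latticeGraph L).Vertex) :
    (latticeGraph L).Reads a w ↔ w.foldl sasaki a.1 ≠ ⊥ := by
  induction w generalizing a with
  | nil => exact ⟨fun _ => a.2, fun _ => trivial⟩
  | cons p w ih =>
    constructor
    · rintro ⟨b, hb, hw⟩ h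
      exact (ih b).1 hw (le_bot_iff.1 ((foldl_sasaki_mono w hb).trans h.le))
    · intro h
      refine ⟨⟨sasaki a.1 p, fun h0 => h ?_⟩, le_rfl, (ih _).2 h⟩
      rw [List.foldl_cons, h0, foldl_sasaki_bot]

theorem mem_latticeGraph_language_iff (w : List L) :
    w ∈ (latticeGraph L).language ↔ sasakiWord w ≠ ⊥ := by
  rw [MeasurementGraph.mem_language_iff, sasakiWord_eq_foldl]
  constructor
  · rintro ⟨a, ha⟩ h
    exact (latticeGraph_reads_iff w a).1 ha
      (le_bot_iff.1 ((foldl_sasaki_mono w le_top).trans h.le))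
  · intro h
    refine ⟨⟨⊤, fun h0 => h ?_⟩, (latticeGraph_reads_iff w _).2 h⟩
    rw [h0, foldl_sasaki_bot]

namespace MeasurementGraph.IsModel

variable {G : MeasurementGraph.{u, v} L}

theorem foldl_sasaki_ne_bot (hG : G.IsModel) (w : List L) {a : G.Vertex} {p : L}
    (hp : G.Verifies a p) (hw : G.Reads a w) : w.foldl sasaki p ≠ ⊥ := by
  induction w generalizing a p with
  | nil => rintro rfl; exact hG.not_verifies_bot a hp
  | cons q w ih =>
    obtain ⟨b, hb, hw⟩ := hw
    exact ih (hG.preservation p q a b hp hb) hw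

theorem sasakiWord_ne_bot (hG : G.IsModel) {w : List L} (hw : w ∈ G.language) :
    sasakiWord w ≠ ⊥ := by
  obtain ⟨a, ha⟩ := (G.mem_language_iff w).1 hw
  rw [sasakiWord_eq_foldl]
  exact hG.foldl_sasaki_ne_bot w (hG.verifies_top a) ha

/-- A vertex that does not verify `pᶜ` has an outgoing arrow labelled `p`, and preservation of `⊤`
along it makes its target verify `sasaki ⊤ p = p`. -/
theorem exists_verifies (hG : G.IsModel) {p : L} (hp : p ≠ ⊥) : ∃ a, G.Verifies a p := by
  obtain ⟨a, ha⟩ := hG.exists_not_verifies pᶜ fun h => hp (by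
    rw [← OrthomodularLattice.compl_compl' p, h, compl_top_orthomodular])
  obtain ⟨b, hb⟩ := not_not.1 ha
  rw [OrthomodularLattice.compl_compl'] at hb
  exact ⟨b, top_sasaki p ▸ hG.preservation ⊤ p a b (hG.verifies_top a) hb⟩

end MeasurementGraph.IsModel

/-- A set of propositions is Sasaki closed if it is an upper set that is closed under the Sasaki
projection and does not contain `⊥`. -/
structure IsSasakiClosed (T : L → Prop) : Prop where
  mono : ∀ {p q : L}, p ≤ q → T p → T q
  sasaki_mem : ∀ {p q : L}, T p → T q → T (sasaki p q)
  not_bot : ¬ T ⊥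

theorem MeasurementGraph.IsModel.isSasakiClosed {G : MeasurementGraph.{u, v} L} (hG : G.IsModel)
    (a : G.Vertex) : IsSasakiClosed (G.Verifies a) where
  mono h := hG.verifies_mono _ _ h a
  sasaki_mem := hG.verifies_sasaki _ _ a
  not_bot := hG.not_verifies_bot a

end Orthomodular

/-! ### The Hilbert graph and Sasaki projections as images of subspaces. -/

section Hilbert

variable {𝕜 : Type v} {H : Type u} [RCLike 𝕜] [NormedAddCommGroup H] [InnerProductSpace 𝕜 H]

variable (𝕜) in
/-- The closed subspace spanned by one vector. -/
def line (x : H) : ClosedSubmodule 𝕜 H :=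
  ⟨Submodule.span 𝕜 {x}, Submodule.closed_of_finiteDimensional _⟩

theorem mem_line {x y : H} : y ∈ line 𝕜 x ↔ ∃ c : 𝕜, c • x = y :=
  Submodule.mem_span_singleton

theorem self_mem_line (x : H) : x ∈ line 𝕜 x := mem_line.2 ⟨1, one_smul _ _⟩

theorem line_le_iff {x : H} {p : ClosedSubmodule 𝕜 H} : line 𝕜 x ≤ p ↔ x ∈ p :=
  Submodule.span_singleton_le_iff_mem x p.toSubmodule

theorem line_ne_bot {x : H} (hx : x ≠ 0) : line 𝕜 x ≠ ⊥ := fun h =>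
  hx ((h ▸ self_mem_line x : x ∈ (⊥ : ClosedSubmodule 𝕜 H)))

theorem line_zero : line 𝕜 (0 : H) = ⊥ := le_bot_iff.1 (line_le_iff.2 rfl)

variable [CompleteSpace H]

theorem mem_compl_iff_starProjection {x : H} {p : ClosedSubmodule 𝕜 H} :
    x ∈ pᶜ ↔ p.toSubmodule.starProjection x = 0 :=
  (Submodule.starProjection_apply_eq_zero_iff _).symm

theorem mem_compl_line {x s : H} : x ∈ (line 𝕜 s)ᶜ ↔ inner 𝕜 s x = 0 :=
  Submodule.mem_orthogonal_singleton_iff_inner_right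

theorem projectionWord_cons (p : ClosedSubmodule 𝕜 H) (w : List (ClosedSubmodule 𝕜 H)) (x : H) :
    projectionWord (p :: w) x = projectionWord w (p.toSubmodule.starProjection x) := by
  simp [projectionWord]

/-- Normalization only rescales by a nonzero scalar, which does not affect whether later projections
vanish. -/
theorem hilbertGraph_reads_iff (w : List (ClosedSubmodule 𝕜 H)) (φ : (hilbertGraph 𝕜 H).Vertex) :
    (hilbertGraph 𝕜 H).Reads φ w ↔ projectionWord w φ.1 ≠ 0 := by
  induction w generalizing φ with
  | nil =>
    refine ⟨fun _ h => ?_, fun _ => trivial⟩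
    have h0 : φ.1 = 0 := h
    simpa [h0] using φ.2
  | cons p w ih =>
    rw [projectionWord_cons]
    constructor
    · rintro ⟨ψ, ⟨-, hψ⟩, hw⟩ h
      refine (ih ψ).1 hw ?_
      rw [hψ, map_smul, h, smul_zero]
    · intro h
      have h0 : p.toSubmodule.starProjection φ.1 ≠ 0 := fun h0 => h (by rw [h0, map_zero])
      have h1 : ‖p.toSubmodule.starProjection φ.1‖ ≠ 0 := norm_ne_zero_iff.2 h0
      refine ⟨⟨((‖p.toSubmodule.starProjection φ.1‖⁻¹ : ℝ) : 𝕜) •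
        p.toSubmodule.starProjection φ.1, ?_⟩, ⟨h1, rfl⟩, (ih _).2 ?_⟩
      · rw [norm_smul, RCLike.norm_ofReal, abs_of_nonneg (by positivity), inv_mul_cancel₀ h1]
      · rw [map_smul]
        exact smul_ne_zero (RCLike.ofReal_ne_zero.2 (inv_ne_zero h1)) h

theorem mem_hilbertGraph_language_iff (w : List (ClosedSubmodule 𝕜 H)) :
    w ∈ (hilbertGraph 𝕜 H).language ↔ projectionWord w ≠ 0 := by
  rw [MeasurementGraph.mem_language_iff]
  constructor
  · rintro ⟨φ, hφ⟩ h
    exact (hilbertGraph_reads_iff w φ).1 hφ (by rw [h]; rfl)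
  · intro h
    obtain ⟨x, hx⟩ := DFunLike.ne_iff.1 h
    have hx0 : x ≠ 0 := by rintro rfl; exact hx (by simp)
    have h1 : ‖x‖ ≠ 0 := norm_ne_zero_iff.2 hx0
    refine ⟨⟨((‖x‖⁻¹ : ℝ) : 𝕜) • x, ?_⟩, (hilbertGraph_reads_iff w _).2 ?_⟩
    · rw [norm_smul, RCLike.norm_ofReal, abs_of_nonneg (by positivity), inv_mul_cancel₀ h1]
    · rw [map_smul]
      exact smul_ne_zero (RCLike.ofReal_ne_zero.2 (inv_ne_zero h1)) hx

variable [FiniteDimensional 𝕜 H]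

theorem mem_sasaki_iff {p q : ClosedSubmodule 𝕜 H} {x : H} :
    x ∈ sasaki p q ↔ ∃ y ∈ p, q.toSubmodule.starProjection y = x := by
  -- The join is the closure of the sum; in finite dimension the sum is already closed.
  have hsup : x ∈ p ⊔ qᶜ ↔ x ∈ p.toSubmodule ⊔ q.toSubmoduleᗮ := by
    change x ∈ (p.toSubmodule ⊔ q.toSubmoduleᗮ).topologicalClosure ↔ _
    rw [(Submodule.closed_of_finiteDimensional _).submodule_topologicalClosure_eq]
  rw [sasaki, ClosedSubmodule.mem_inf, hsup, Submodule.mem_sup]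
  constructor
  · rintro ⟨hx, y, hy, z, hz, rfl⟩
    refine ⟨y, hy, Submodule.eq_starProjection_of_mem_orthogonal hx ?_⟩
    rw [sub_add_cancel_left]
    exact neg_mem hz
  · rintro ⟨y, hy, rfl⟩
    refine ⟨Submodule.starProjection_apply_mem _ _, y, hy, _,
      neg_mem (Submodule.sub_starProjection_mem_orthogonal (K := q.toSubmodule) y), by abel⟩

theorem mem_foldl_sasaki_iff (w : List (ClosedSubmodule 𝕜 H)) {p : ClosedSubmodule 𝕜 H} {x : H} :
    x ∈ w.foldl sasaki p ↔ ∃ y ∈ p, projectionWord w y = x := by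
  induction w generalizing p with
  | nil => exact ⟨fun h => ⟨x, h, rfl⟩, fun ⟨y, h, e⟩ => (show y = x from e) ▸ h⟩
  | cons q w ih =>
    simp [ih, mem_sasaki_iff, projectionWord_cons]

theorem sasakiWord_ne_bot_iff (w : List (ClosedSubmodule 𝕜 H)) :
    sasakiWord w ≠ ⊥ ↔ projectionWord w ≠ 0 := by
  refine not_congr ?_
  rw [sasakiWord_eq_foldl]
  constructor
  · intro h
    ext x
    exact (h ▸ (mem_foldl_sasaki_iff w).2 ⟨x, trivial, rfl⟩ :
      projectionWord w x ∈ (⊥ : ClosedSubmodule 𝕜 H))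
  · intro h
    refine le_bot_iff.1 fun x hx => ?_
    obtain ⟨y, -, rfl⟩ := (mem_foldl_sasaki_iff w).1 hx
    rw [h]
    rfl

theorem line_sasaki (x : H) (q : ClosedSubmodule 𝕜 H) :
    sasaki (line 𝕜 x) q = line 𝕜 (q.toSubmodule.starProjection x) := by
  ext y
  have : y ∈ sasaki (line 𝕜 x) q ↔ y ∈ line 𝕜 (q.toSubmodule.starProjection x) := by
    simp [mem_sasaki_iff, mem_line]
  exact this

end Hilbert

/-! ### Pairs of lines in a Sasaki closed set. -/

section Lines

variable {𝕜 : Type*} {H : Type u} [RCLike 𝕜] [NormedAddCommGroup H] [InnerProductSpace 𝕜 H]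

theorem exists_orthogonal_of_norm [FiniteDimensional 𝕜 H] (hdim : 3 ≤ Module.finrank 𝕜 H)
    (v w : H) {r : ℝ} (hr : 0 ≤ r) :
    ∃ z : H, inner 𝕜 z v = 0 ∧ inner 𝕜 z w = 0 ∧ ‖z‖ = r := by
  have hlt : Module.finrank 𝕜 (Submodule.span 𝕜 {v, w}) < Module.finrank 𝕜 H := by
    have h := finrank_range_le_card (R := 𝕜) ![v, w]
    rw [Matrix.range_cons_cons_empty, Fintype.card_fin] at h
    exact h.trans_lt hdim
  obtain ⟨z, hz, hz0⟩ := Submodule.exists_mem_ne_zero_of_ne_bot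
    (p := (Submodule.span 𝕜 {v, w})ᗮ) fun h => by
      rw [Submodule.orthogonal_eq_bot_iff] at h
      rw [h, finrank_top] at hlt
      exact lt_irrefl _ hlt
  rw [Submodule.mem_orthogonal'] at hz
  have h1 : ‖z‖ ≠ 0 := norm_ne_zero_iff.2 hz0
  refine ⟨((r * ‖z‖⁻¹ : ℝ) : 𝕜) • z, ?_, ?_, ?_⟩
  · rw [inner_smul_left, hz v (Submodule.subset_span (by simp)), mul_zero]
  · rw [inner_smul_left, hz w (Submodule.subset_span (by simp)), mul_zero]
  · rw [norm_smul, RCLike.norm_ofReal, abs_of_nonneg (by positivity), inv_mul_cancel_right₀ h1]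

theorem line_smul {c : 𝕜} (hc : c ≠ 0) (x : H) : line 𝕜 (c • x) = line 𝕜 x :=
  ClosedSubmodule.toSubmodule_injective (Submodule.span_singleton_smul_eq hc.isUnit x)

namespace IsSasakiClosed

variable [CompleteSpace H] [FiniteDimensional 𝕜 H] {T : ClosedSubmodule 𝕜 H → Prop}

theorem inner_ne_zero (hT : IsSasakiClosed T) {x y : H} (hx : T (line 𝕜 x)) (hy : T (line 𝕜 y)) :
    inner 𝕜 x y ≠ 0 := by
  intro h
  have h1 := hT.sasaki_mem hy hx
  rw [line_sasaki, mem_compl_iff_starProjection.1 (mem_compl_line.2 h), line_zero] at h1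
  exact hT.not_bot h1

/-- A line of `T` may be projected along any vector orthogonal to another line of `T`. -/
theorem line_of_add (hT : IsSasakiClosed T) {v x s : H} (hv : T (line 𝕜 v))
    (hxs : T (line 𝕜 (x + s))) (hsv : inner 𝕜 s v = 0) (hsx : inner 𝕜 s x = 0) :
    T (line 𝕜 x) := by
  -- The hyperplane orthogonal to `s` contains `v`, hence belongs to `T`; `x + s` projects onto it
  -- as `x`.
  have h1 := hT.sasaki_mem hxs (hT.mono (line_le_iff.2 (mem_compl_line.2 hsv)) hv)
  rw [line_sasaki] at h1
  convert h1 using 2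
  refine (Submodule.eq_starProjection_of_mem_orthogonal (mem_compl_line.2 hsx) ?_).symm
  rw [add_sub_cancel_left]
  have h2 := OrthomodularLattice.compl_compl' (line 𝕜 s)
  exact (h2.symm ▸ self_mem_line s : s ∈ (line 𝕜 s)ᶜᶜ)

/-- Two projections turn the offset `w` by a right angle at the cost of halving it: `v + w` goes to
`v + (w + z) / 2`, then to `v + z / 2`. The equality of norms makes `w - z` orthogonal to `w + z`.
-/
theorem add_half (hT : IsSasakiClosed T) {v w z : H} (hv : T (line 𝕜 v))
    (hvw : T (line 𝕜 (v + w))) (hwv : inner 𝕜 w v = 0) (hzv : inner 𝕜 z v = 0)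
    (hzw : inner 𝕜 z w = 0) (hn : ‖z‖ = ‖w‖) : T (line 𝕜 (v + (2⁻¹ : 𝕜) • z)) := by
  have hwz := inner_eq_zero_symm.1 hzw
  have h1 : T (line 𝕜 (v + (2⁻¹ : 𝕜) • (w + z))) := by
    refine hT.line_of_add (s := (2⁻¹ : 𝕜) • (w - z)) hv ?_ ?_ ?_
    · convert hvw using 2
      module
    · simp [inner_smul_left, inner_sub_left, hwv, hzv]
    · simp [inner_smul_left, inner_smul_right, inner_sub_left, inner_add_right, hwv, hzv, hzw, hwz,
        hn, inner_self_eq_norm_sq_to_K]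
  refine hT.line_of_add (s := (2⁻¹ : 𝕜) • w) hv ?_ ?_ ?_
  · convert h1 using 2
    module
  · simp [inner_smul_left, hwv]
  · simp [inner_smul_left, inner_smul_right, inner_add_right, hwv, hwz]

theorem sub_quarter (hdim : 3 ≤ Module.finrank 𝕜 H) (hT : IsSasakiClosed T) {v w : H}
    (hv : T (line 𝕜 v)) (hvw : T (line 𝕜 (v + w))) (hwv : inner 𝕜 w v = 0) :
    T (line 𝕜 (v - (4⁻¹ : 𝕜) • w)) := by
  obtain ⟨z, hzv, hzw, hn⟩ := exists_orthogonal_of_norm hdim v w (norm_nonneg w)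
  have h1 := hT.add_half hv hvw hwv hzv hzw hn
  -- A second quarter turn brings the offset `z / 2` to `-w / 4`, on the other side of `v`.
  have h2 := hT.add_half (z := -((2⁻¹ : 𝕜) • w)) hv h1 (by simp [inner_smul_left, hzv])
    (by simp [inner_smul_left, hwv])
    (by simp [inner_smul_left, inner_smul_right, inner_eq_zero_symm.1 hzw])
    (by simp [norm_smul, hn])
  convert h2 using 2
  module

theorem add_smul (hdim : 3 ≤ Module.finrank 𝕜 H) (hT : IsSasakiClosed T) {v w : H}
    (hv : T (line 𝕜 v)) (hvw : T (line 𝕜 (v + w))) (hwv : inner 𝕜 w v = 0) {t : ℝ} (ht : 0 ≤ t)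
    (ht1 : t ≤ 1) : T (line 𝕜 (v + (t : 𝕜) • w)) := by
  -- The norm is the height over `t • w` in the Thales circle with diameter from `0` to `w`: it
  -- makes `t • w + z` orthogonal to `(1 - t) • w - z`. Projecting once more then removes `z`.
  obtain ⟨z, hzv, hzw, hn⟩ := exists_orthogonal_of_norm hdim v w
    (r := √(t * (1 - t)) * ‖w‖) (by positivity)
  have hwz := inner_eq_zero_symm.1 hzw
  have hsq : ‖z‖ ^ 2 = t * (1 - t) * ‖w‖ ^ 2 := by
    rw [hn, mul_pow, Real.sq_sqrt (mul_nonneg ht (by linarith))]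
  have hsq' : (‖z‖ : 𝕜) ^ 2 = t * (1 - t) * (‖w‖ : 𝕜) ^ 2 := by
    exact_mod_cast congrArg (RCLike.ofReal (K := 𝕜)) hsq
  have h1 : T (line 𝕜 (v + (t : 𝕜) • w + z)) := by
    refine hT.line_of_add (s := (1 - t : 𝕜) • w - z) hv ?_ ?_ ?_
    · convert hvw using 2
      module
    · simp [inner_smul_left, inner_sub_left, hwv, hzv]
    · simp [inner_smul_left, inner_smul_right, inner_sub_left, inner_add_right, hwv, hzv, hzw, hwz,
        inner_self_eq_norm_sq_to_K, hsq']
      ring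
  exact hT.line_of_add hv h1 hzv (by simp [inner_add_right, inner_smul_right, hzv, hzw])

/-- Otherwise `w` can be shrunk by `t = 4‖v‖² / ‖w‖² ≤ 1`, and `sub_quarter` gives the line of `v -
(t / 4) • w`. This `t` is the one that makes it orthogonal to `v + w`, which `inner_ne_zero`
forbids. -/
theorem norm_sq_lt (hdim : 3 ≤ Module.finrank 𝕜 H) (hT : IsSasakiClosed T) {v w : H}
    (hv : T (line 𝕜 v)) (hvw : T (line 𝕜 (v + w))) (hwv : inner 𝕜 w v = 0) :
    ‖w‖ ^ 2 < 4 * ‖v‖ ^ 2 := by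
  by_contra! h
  have hvwi := inner_eq_zero_symm.1 hwv
  have hv0 : 0 < ‖v‖ := norm_pos_iff.2 fun h0 => by
    rw [h0, line_zero] at hv
    exact hT.not_bot hv
  have hw0 : 0 < ‖w‖ ^ 2 := lt_of_lt_of_le (by positivity) h
  set t : ℝ := 4 * ‖v‖ ^ 2 / ‖w‖ ^ 2 with ht
  have h1 := hT.add_smul hdim hv hvw hwv (t := t) (by positivity) (by rwa [ht, div_le_one hw0])
  have h2 := hT.sub_quarter hdim hv h1 (by simp [inner_smul_left, hwv])
  refine hT.inner_ne_zero hvw h2 ?_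
  have h3 : (t : 𝕜) * (‖w‖ : 𝕜) ^ 2 = 4 * (‖v‖ : 𝕜) ^ 2 := by
    have : t * ‖w‖ ^ 2 = 4 * ‖v‖ ^ 2 := div_mul_cancel₀ _ hw0.ne'
    exact_mod_cast congrArg (RCLike.ofReal (K := 𝕜)) this
  simp only [inner_add_left, inner_sub_right, inner_smul_right, hwv, hvwi,
    inner_self_eq_norm_sq_to_K]
  linear_combination (-4⁻¹ : 𝕜) * h3

/-- The new pair is `v + w` and `v - w / 4`, on opposite sides of `v`. If `τ = ‖w‖ / ‖v‖` is the
tangent of the old angle, that of the new one is `(5 / 4) τ / (1 - τ² / 4)`, at least `(5 / 4) τ`;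
the inequality compares squares. -/
theorem exists_larger_angle (hdim : 3 ≤ Module.finrank 𝕜 H) (hT : IsSasakiClosed T) {v w : H}
    (hv : T (line 𝕜 v)) (hvw : T (line 𝕜 (v + w))) (hwv : inner 𝕜 w v = 0) :
    ∃ v' w' : H, T (line 𝕜 v') ∧ T (line 𝕜 (v' + w')) ∧ inner 𝕜 w' v' = 0 ∧
      25 / 16 * ‖w‖ ^ 2 * ‖v'‖ ^ 2 ≤ ‖v‖ ^ 2 * ‖w'‖ ^ 2 := by
  have hlt := hT.norm_sq_lt hdim hv hvw hwv
  have hvwi := inner_eq_zero_symm.1 hwv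
  have hv0 : 0 < ‖v‖ ^ 2 := by nlinarith [sq_nonneg ‖w‖]
  set V := ‖v‖ ^ 2
  set W := ‖w‖ ^ 2
  have hW : 0 ≤ W := sq_nonneg _
  have hD : 0 < V - W / 4 := by linarith
  -- The scale at which `a • (v - w / 4)` projects to `v + w` on the line of `v + w`, so that their
  -- difference is orthogonal to `v + w`.
  set a : ℝ := (V + W) / (V - W / 4) with ha
  have ha0 : 0 < a := by positivity
  have haV : a * (V - W / 4) = V + W := div_mul_cancel₀ _ hD.ne'
  have hVW : (v + w) + ((a - 1 : 𝕜) • v - (1 + a / 4 : 𝕜) • w) =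
      (a : 𝕜) • (v - (4⁻¹ : 𝕜) • w) := by module
  refine ⟨v + w, (a - 1 : 𝕜) • v - (1 + a / 4 : 𝕜) • w, hvw, ?_, ?_, ?_⟩
  · rw [hVW, line_smul (RCLike.ofReal_ne_zero.2 ha0.ne')]
    exact hT.sub_quarter hdim hv hvw hwv
  · have h3 : (a : 𝕜) * ((‖v‖ : 𝕜) ^ 2 - (‖w‖ : 𝕜) ^ 2 / 4) = (‖v‖ : 𝕜) ^ 2 + (‖w‖ : 𝕜) ^ 2 := by
      exact_mod_cast congrArg (RCLike.ofReal (K := 𝕜)) haV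
    simp [inner_sub_left, inner_add_right, inner_smul_left, hwv, hvwi,
      inner_self_eq_norm_sq_to_K, (map_ofNat (starRingEnd 𝕜) 4 : starRingEnd 𝕜 4 = 4)]
    linear_combination h3
  · have e1 : ‖v + w‖ ^ 2 = V + W := by
      have := norm_add_sq_eq_norm_sq_add_norm_sq_of_inner_eq_zero (𝕜 := 𝕜) v w hvwi
      simpa [sq, V, W] using this
    have e2 : ‖(a - 1 : 𝕜) • v - (1 + a / 4 : 𝕜) • w‖ ^ 2 =
        (a - 1) ^ 2 * V + (1 + a / 4) ^ 2 * W := by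
      have := norm_add_sq_eq_norm_sq_add_norm_sq_of_inner_eq_zero (𝕜 := 𝕜) ((a - 1 : 𝕜) • v)
        (-((1 + a / 4 : 𝕜) • w)) (by simp [inner_smul_left, inner_smul_right, hvwi])
      have n1 : ‖(a - 1 : 𝕜)‖ ^ 2 = (a - 1) ^ 2 := by
        rw [← RCLike.ofReal_one, ← RCLike.ofReal_sub, RCLike.norm_ofReal, sq_abs]
      have n2 : ‖(1 + a / 4 : 𝕜)‖ ^ 2 = (1 + a / 4) ^ 2 := by
        rw [show (1 + a / 4 : 𝕜) = ((1 + a / 4 : ℝ) : 𝕜) by push_cast; rfl, RCLike.norm_ofReal,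
          sq_abs]
      rw [← sub_eq_add_neg, norm_neg, ← sq, ← sq, ← sq, norm_smul, norm_smul, mul_pow, mul_pow,
        n1, n2] at this
      exact this
    rw [e1, e2]
    have e3 : a - 1 = 5 / 4 * W / (V - W / 4) := by
      rw [eq_div_iff hD.ne']; linear_combination haV
    have e4 : 1 + a / 4 = 5 / 4 * V / (V - W / 4) := by
      rw [eq_div_iff hD.ne']; linear_combination haV / 4
    rw [e3, e4]
    have e5 : V * ((5 / 4 * W / (V - W / 4)) ^ 2 * V + (5 / 4 * V / (V - W / 4)) ^ 2 * W) =
        25 / 16 * W * (V + W) * (V ^ 2 / (V - W / 4) ^ 2) := by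
      field_simp; ring
    rw [e5]
    refine le_mul_of_one_le_right (by positivity) ?_
    rw [one_le_div (by positivity)]
    exact pow_le_pow_left₀ hD.le (by linarith) 2

/-- For `w ≠ 0`, iterating `exists_larger_angle` makes the squared tangent grow at least
geometrically, while `norm_sq_lt` keeps it below `4`. -/
theorem eq_zero_of_line_add (hdim : 3 ≤ Module.finrank 𝕜 H) (hT : IsSasakiClosed T) {v w : H}
    (hv : T (line 𝕜 v)) (hvw : T (line 𝕜 (v + w))) (hwv : inner 𝕜 w v = 0) : w = 0 := by
  by_contra hw
  have key : ∀ n : ℕ, ∃ v' w' : H, T (line 𝕜 v') ∧ T (line 𝕜 (v' + w')) ∧ inner 𝕜 w' v' = 0 ∧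
      (25 / 16 : ℝ) ^ n * ‖w‖ ^ 2 * ‖v'‖ ^ 2 ≤ ‖v‖ ^ 2 * ‖w'‖ ^ 2 := by
    intro n
    induction n with
    | zero => exact ⟨v, w, hv, hvw, hwv, by simp [mul_comm]⟩
    | succ n ih =>
      obtain ⟨x, y, hx, hxy, hyx, h⟩ := ih
      obtain ⟨x', y', hx', hxy', hyx', h'⟩ := hT.exists_larger_angle hdim hx hxy hyx
      refine ⟨x', y', hx', hxy', hyx', ?_⟩
      have hx0 : 0 < ‖x‖ ^ 2 := by
        nlinarith [hT.norm_sq_lt hdim hx hxy hyx, sq_nonneg ‖y‖]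
      refine le_of_mul_le_mul_right ?_ hx0
      calc (25 / 16 : ℝ) ^ (n + 1) * ‖w‖ ^ 2 * ‖x'‖ ^ 2 * ‖x‖ ^ 2
          = ((25 / 16 : ℝ) ^ n * ‖w‖ ^ 2 * ‖x‖ ^ 2) * (25 / 16 * ‖x'‖ ^ 2) := by ring
        _ ≤ (‖v‖ ^ 2 * ‖y‖ ^ 2) * (25 / 16 * ‖x'‖ ^ 2) := by gcongr
        _ = ‖v‖ ^ 2 * (25 / 16 * ‖y‖ ^ 2 * ‖x'‖ ^ 2) := by ring
        _ ≤ ‖v‖ ^ 2 * (‖x‖ ^ 2 * ‖y'‖ ^ 2) := by gcongr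
        _ = ‖v‖ ^ 2 * ‖y'‖ ^ 2 * ‖x‖ ^ 2 := by ring
  have hw0 : 0 < ‖w‖ ^ 2 := by positivity
  obtain ⟨n, hn⟩ := pow_unbounded_of_one_lt (4 * ‖v‖ ^ 2 / ‖w‖ ^ 2)
    (by norm_num : (1 : ℝ) < 25 / 16)
  rw [div_lt_iff₀ hw0] at hn
  obtain ⟨x, y, hx, hxy, hyx, h⟩ := key n
  have h1 := hT.norm_sq_lt hdim hx hxy hyx
  have hx0 : 0 < ‖x‖ ^ 2 := by nlinarith [sq_nonneg ‖y‖]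
  have h2 : 4 * ‖v‖ ^ 2 * ‖x‖ ^ 2 < (25 / 16 : ℝ) ^ n * ‖w‖ ^ 2 * ‖x‖ ^ 2 :=
    mul_lt_mul_of_pos_right hn hx0
  nlinarith [sq_nonneg ‖v‖]

/-- In dimension at least three, a line of `T` lies below every member of `T`. -/
theorem mem_of_line (hdim : 3 ≤ Module.finrank 𝕜 H) (hT : IsSasakiClosed T) {x : H}
    {p : ClosedSubmodule 𝕜 H} (hx : T (line 𝕜 x)) (hp : T p) : x ∈ p := by
  have h1 := hT.sasaki_mem hx hp
  rw [line_sasaki] at h1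
  -- The two lines compared are those of the projection of `x` onto `p` and of `x` itself.
  have h2 := hT.eq_zero_of_line_add hdim (w := x - p.toSubmodule.starProjection x) h1
    (by rwa [add_sub_cancel]) (Submodule.inner_left_of_mem_orthogonal
      (Submodule.starProjection_apply_mem _ _) (Submodule.sub_starProjection_mem_orthogonal x))
  rw [sub_eq_zero.1 h2]
  exact Submodule.starProjection_apply_mem _ _

end IsSasakiClosed

/-! ### The language of a model. -/

namespace MeasurementGraph.IsModel

variable [CompleteSpace H] [FiniteDimensional 𝕜 H]
  {G : MeasurementGraph.{u, v} (ClosedSubmodule 𝕜 H)}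

theorem reads_of_verifies_line (hdim : 3 ≤ Module.finrank 𝕜 H) (hG : G.IsModel)
    (w : List (ClosedSubmodule 𝕜 H)) {x : H} {a : G.Vertex} (ha : G.Verifies a (line 𝕜 x))
    (hx : projectionWord w x ≠ 0) : G.Reads a w := by
  induction w generalizing x a with
  | nil => trivial
  | cons p w ih =>
    rw [projectionWord_cons] at hx
    have h1 : ¬ G.Verifies a pᶜ := fun h => hx <| by
      rw [mem_compl_iff_starProjection.1 ((hG.isSasakiClosed a).mem_of_line hdim ha h), map_zero]
    obtain ⟨b, hb⟩ := not_not.1 h1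
    rw [OrthomodularLattice.compl_compl'] at hb
    exact ⟨b, hb, ih (line_sasaki x p ▸ hG.preservation _ p a b ha hb) hx⟩

theorem mem_language_iff_projectionWord (hdim : 3 ≤ Module.finrank 𝕜 H) (hG : G.IsModel)
    (w : List (ClosedSubmodule 𝕜 H)) : w ∈ G.language ↔ projectionWord w ≠ 0 := by
  refine ⟨fun h => (sasakiWord_ne_bot_iff w).1 (hG.sasakiWord_ne_bot h), fun h => ?_⟩
  obtain ⟨x, hx⟩ := DFunLike.ne_iff.1 h
  have hx0 : x ≠ 0 := by rintro rfl; exact hx (by simp)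
  obtain ⟨a, ha⟩ := hG.exists_verifies (line_ne_bot (𝕜 := 𝕜) hx0)
  exact (G.mem_language_iff w).2 ⟨a, hG.reads_of_verifies_line hdim w ha hx⟩

end MeasurementGraph.IsModel

end Lines

theorem mainTheorem1 {𝕜 : Type*} {H : Type u} [RCLike 𝕜] [NormedAddCommGroup H]
    [InnerProductSpace 𝕜 H] [CompleteSpace H] [FiniteDimensional 𝕜 H]
    (hdim : 3 ≤ Module.finrank 𝕜 H) :
    (∀ G : MeasurementGraph.{u, v} (ClosedSubmodule 𝕜 H), G.IsModel →
      G.language = (latticeGraph (ClosedSubmodule 𝕜 H)).language ∧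
      G.language = (hilbertGraph 𝕜 H).language) ∧
    (latticeGraph (ClosedSubmodule 𝕜 H)).language = (hilbertGraph 𝕜 H).language ∧
    (∀ w : List (ClosedSubmodule 𝕜 H),
      (w ∈ (latticeGraph (ClosedSubmodule 𝕜 H)).language ↔ sasakiWord w ≠ ⊥) ∧
      (w ∈ (hilbertGraph 𝕜 H).language ↔ projectionWord w ≠ 0)) := by
  have hL : ∀ w : List (ClosedSubmodule 𝕜 H),
      w ∈ (latticeGraph (ClosedSubmodule 𝕜 H)).language ↔ projectionWord w ≠ 0 := fun w =>
    (mem_latticeGraph_language_iff w).trans (sasakiWord_ne_bot_iff w)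
  refine ⟨fun G hG => ⟨?_, ?_⟩, ?_,
    fun w => ⟨mem_latticeGraph_language_iff w, mem_hilbertGraph_language_iff w⟩⟩
  · ext w
    rw [hG.mem_language_iff_projectionWord hdim, hL]
  · ext w
    rw [hG.mem_language_iff_projectionWord hdim, mem_hilbertGraph_language_iff]
  · ext w
    rw [hL, mem_hilbertGraph_language_iff]
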